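/- Let $N$ be a finite set of agents and $\Theta$ a set of atomic propositions. The formulas of the logic CLD (coalition logic with individual and distributed knowledge) are given by $$\varphi ::= p \mid \neg\varphi \mid \varphi\wedge\varphi \mid [H]\varphi \mid K_i\varphi \mid D_G\varphi ,$$ where $p\in\Theta$, $i\in N$, $H\subseteq N$ and $\emptyset\neq G\subseteq N$; the other connectives are abbreviations, with $\varphi\to\psi := \neg(\varphi\wedge\neg\psi)$, $\bot$ any formula $\chi\wedge\neg\chi$, and $\top := \neg\bot$. We write $D_i$ for $D_{\{i\}}$. The Hilbert system CLD has as axioms all substitution instances of propositional tautologies and all instances of - $\neg[H]\bot$; $\;[H]\top$; $\;\neg[\emptyset]\neg\varphi\to[N]\varphi$; $\;[H](\varphi\wedge\psi)\to[H]\psi$; $\;[H_1]\varphi\wedge[H_2]\psi\to[H_1\cup H_2](\varphi\wedge\psi)$ if $H_1\cap H_2=\emptyset$; - $\square(\varphi\to\psi)\to(\square\varphi\to\square\psi)$, $\;\square\varphi\to\varphi$, $\;\square\varphi\to\square\square\varphi$, $\;\neg\square\varphi\to\square\neg\square\varphi$, for each $\square=K_i$ ($i\in N$) and each $\square=D_G$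 ($\emptyset\ne G\subseteq N$); - $K_i\varphi\leftrightarrow D_i\varphi$; $\;D_G\varphi\to D_{G'}\varphi$ if $\emptyset\neq G\subseteq G'\subseteq N$; and as rules modus ponens, from $\varphi\leftrightarrow\psi$ infer $[H]\varphi\leftrightarrow[H]\psi$, and from $\varphi$ infer $K_i\varphi$. A formula $\varphi$ is CLD-consistent if $\neg\varphi$ is not derivable. A pseudomodel $M=(S,\{\sim_i\}_{i\in N},\{R_G\}_{\emptyset\ne G\subseteq N},E,V)$ consists of a non-empty set $S$ of states; equivalence relations $\sim_i$ and $R_G$ on $S$ with $R_{\{i\}}={\sim_i}$ for all $i\in N$, and $R_{H}\subseteq R_{G}$ whenever $\emptyset\neq G\subseteq H\subseteq N$; a valuation assigning to each state $s$ a set $V(s)\subseteq\Theta$; and for each state $s$ and coalition $G\subseteq N$ a family $E(s)(G)$ of subsets of $S$ such that for every $s\in S$: - (E1) $\emptyset\notin E(s)(G)$ for all $G\subseteq N$; - (E2) $S\in E(s)(G)$ for all $G\subseteq N$; - (E3) for all $X\subseteq S$, $S\setminus X\notin E(s)(\emptyset)$ implies $X\in E(s)(N)$; - (E4) for all $G\subseteq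 N$ and $X\subseteq Y\subseteq S$, $X\in E(s)(G)$ implies $Y\in E(s)(G)$; - (E5) for all $G_1,G_2\subseteq N$ with $G_1\cap G_2=\emptyset$ and all $X,Y\subseteq S$, $X\in E(s)(G_1)$ and $Y\in E(s)(G_2)$ imply $X\cap Y\in E(s)(G_1\cup G_2)$; - (E6) $E(s)(\emptyset)$ has an inclusion-minimal element. Truth is defined by: $M,s\models p$ iff $p\in V(s)$; the usual clauses for $\neg$ and $\wedge$; $M,s\models[G]\varphi$ iff $\{t\in S: M,t\models\varphi\}\in E(s)(G)$; $M,s\models K_i\varphi$ iff $M,t\models\varphi$ for all $t$ with $s\sim_i t$; and $M,s\models D_G\varphi$ iff $M,t\models\varphi$ for all $t$ with $s R_G t$. **Lemma (finite pseudomodel).** Every CLD-consistent formula is satisfied at some state of a pseudomodel (in which, in particular, E1–E6 hold) whose set of states is finite. -/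

import Mathlib

namespace CoalitionLogic

/-- Nonempty coalitions of agents. -/
abbrev NECoalition (N : Type*) := {G : Set N // G.Nonempty}

/-- The singleton coalition of an agent. -/
def NECoalition.single {N : Type*} (i : N) : NECoalition N := ⟨{i}, Set.singleton_nonempty i⟩

/-- Formulas of coalition logic with individual and distributed knowledge, over agents `N` and
atomic propositions `Θ`: `coal G φ` is `[G]φ`, `know i φ` is `K_i φ`, `dist G φ` is `D_G φ`. -/
inductive Form (N : Type*) (Θ : Type*) where
  | atom (p : Θ) : Form N Θ
  | neg (φ : Form N Θ) : Form N Θ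
  | and (φ ψ : Form N Θ) : Form N Θ
  | coal (G : Set N) (φ : Form N Θ) : Form N Θ
  | know (i : N) (φ : Form N Θ) : Form N Θ
  | dist (G : NECoalition N) (φ : Form N Θ) : Form N Θ

namespace Form

variable {N : Type*} {Θ : Type*}

/-- Implication, as a derived connective. -/
def imp (φ ψ : Form N Θ) : Form N Θ := neg (and φ (neg ψ))

/-- Biconditional, as a derived connective. -/
def iff (φ ψ : Form N Θ) : Form N Θ := and (imp φ ψ) (imp ψ φ)

/-- Falsum as the derived formula `χ ∧ ¬χ`. The primitive language has no constant, so the formula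
`χ` used for the abbreviation is a parameter; the axioms below admit every choice of it. -/
def bot (χ : Form N Θ) : Form N Θ := and χ (neg χ)

/-- Verum as the derived formula `¬(χ ∧ ¬χ)`. -/
def top (χ : Form N Θ) : Form N Θ := neg (bot χ)

/-- Propositional truth value under an assignment `v` to the formulas that are not negations or
conjunctions. -/
def propEval (v : Form N Θ → Prop) : Form N Θ → Prop
  | neg φ => ¬ propEval v φ
  | and φ ψ => propEval v φ ∧ propEval v ψ
  | atom p => v (atom p)
  | coal G φ => v (coal G φ)
  | know i φ => v (know i φ)
  | dist G φ => v (dist G φ)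

/-- Substitution instances of classical propositional tautologies. -/
def IsTautology (φ : Form N Θ) : Prop := ∀ v : Form N Θ → Prop, propEval v φ

end Form

open Form in
/-- The Hilbert system `CLD`. -/
inductive CLD {N : Type*} {Θ : Type*} : Form N Θ → Prop where
  | prop {φ : Form N Θ} (h : IsTautology φ) : CLD φ
  | G1 (G : Set N) (χ : Form N Θ) : CLD (neg (coal G (bot χ)))
  | G2 (G : Set N) (χ : Form N Θ) : CLD (coal G (top χ))
  | G3 (φ : Form N Θ) : CLD (imp (neg (coal ∅ (neg φ))) (coal Set.univ φ))
  | G4 (G : Set N) (φ ψ : Form N Θ) : CLD (imp (coal G (and φ ψ)) (coal G ψ))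
  | G5 (G₁ G₂ : Set N) (h : G₁ ∩ G₂ = ∅) (φ ψ : Form N Θ) :
      CLD (imp (and (coal G₁ φ) (coal G₂ ψ)) (coal (G₁ ∪ G₂) (and φ ψ)))
  | MP {φ ψ : Form N Θ} (h₁ : CLD φ) (h₂ : CLD (imp φ ψ)) : CLD ψ
  | RG (G : Set N) {φ ψ : Form N Θ} (h : CLD (iff φ ψ)) : CLD (iff (coal G φ) (coal G ψ))
  | K (i : N) (φ ψ : Form N Θ) : CLD (imp (know i (imp φ ψ)) (imp (know i φ) (know i ψ)))
  | T (i : N) (φ : Form N Θ) : CLD (imp (know i φ) φ)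
  | four (i : N) (φ : Form N Θ) : CLD (imp (know i φ) (know i (know i φ)))
  | five (i : N) (φ : Form N Θ) : CLD (imp (neg (know i φ)) (know i (neg (know i φ))))
  | RN (i : N) {φ : Form N Θ} (h : CLD φ) : CLD (know i φ)
  | DK (G : NECoalition N) (φ ψ : Form N Θ) :
      CLD (imp (dist G (imp φ ψ)) (imp (dist G φ) (dist G ψ)))
  | DT (G : NECoalition N) (φ : Form N Θ) : CLD (imp (dist G φ) φ)
  | D4 (G : NECoalition N) (φ : Form N Θ) : CLD (imp (dist G φ) (dist G (dist G φ)))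
  | D5 (G : NECoalition N) (φ : Form N Θ) :
      CLD (imp (neg (dist G φ)) (dist G (neg (dist G φ))))
  | D1 (i : N) (φ : Form N Θ) : CLD (iff (know i φ) (dist (NECoalition.single i) φ))
  | D2 (G H : NECoalition N) (h : G.1 ⊆ H.1) (φ : Form N Θ) : CLD (imp (dist G φ) (dist H φ))

/-- A formula is `CLD`-consistent if its negation is not derivable. -/
def Consistent {N : Type*} {Θ : Type*} (φ : Form N Θ) : Prop := ¬ CLD (Form.neg φ)

/-- The non-monotonic core of a coalition: the inclusion-minimal sets for which it is effective. -/
def nonmonotonicCore {N : Type*} {S : Type*} (E : Set N → Set (Set S)) (G : Set N) :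
    Set (Set S) :=
  {X | X ∈ E G ∧ ¬ ∃ Y, Y ∈ E G ∧ Y ⊂ X}

/-- Truly playable effectivity functions (at one state): conditions E1 to E6. -/
structure TrulyPlayable {N : Type*} {S : Type*} (E : Set N → Set (Set S)) : Prop where
  E1 : ∀ G : Set N, ∅ ∉ E G
  E2 : ∀ G : Set N, Set.univ ∈ E G
  E3 : ∀ X : Set S, Xᶜ ∉ E ∅ → X ∈ E Set.univ
  E4 : ∀ (G : Set N) (X Y : Set S), X ⊆ Y → X ∈ E G → Y ∈ E G
  E5 : ∀ (G₁ G₂ : Set N) (X Y : Set S), G₁ ∩ G₂ = ∅ → X ∈ E G₁ → Y ∈ E G₂ → X ∩ Y ∈ E (G₁ ∪ G₂)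
  E6 : (nonmonotonicCore E ∅).Nonempty

/-- Epistemic coalition models with state space `S`. -/
structure Model (N : Type*) (Θ : Type*) (S : Type*) where
  nonempty : Nonempty S
  /-- `E s G` is the family of sets of states that `G` can force at `s`. -/
  E : S → Set N → Set (Set S)
  trulyPlayable : ∀ s, TrulyPlayable (E s)
  /-- epistemic accessibility relations -/
  sim : N → S → S → Prop
  sim_equiv : ∀ i, Equivalence (sim i)
  V : S → Set Θ

/-- Pseudomodels: models with additional equivalence relations `R G` for nonempty coalitions. -/
structure Pseudomodel (N : Type*) (Θ : Type*) (S : Type*) extends Model N Θ S where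
  R : NECoalition N → S → S → Prop
  R_equiv : ∀ G, Equivalence (R G)
  R_single : ∀ i, R (NECoalition.single i) = sim i
  R_anti : ∀ G H : NECoalition N, G.1 ⊆ H.1 → ∀ s t, R H s t → R G s t

/-- Truth of a formula at a state of a pseudomodel; `D_G` is interpreted by `R G`. -/
def Pseudomodel.Sat {N : Type*} {Θ : Type*} {S : Type*} (M : Pseudomodel N Θ S) :
    S → Form N Θ → Prop
  | s, .atom p => p ∈ M.V s
  | s, .neg φ => ¬ M.Sat s φ
  | s, .and φ ψ => M.Sat s φ ∧ M.Sat s ψ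
  | s, .coal G φ => {t | M.Sat t φ} ∈ M.E s G
  | s, .know i φ => ∀ t, M.sim i s t → M.Sat t φ
  | s, .dist G φ => ∀ t, M.R G s t → M.Sat t φ

end CoalitionLogic

namespace CoalitionLogic

open Form

variable {N : Type*} {Θ : Type*}

/-! The model is a filtration of the canonical model through the finite closure of `φ`. A state is
the trace of a maximal theory on that list, and one theory is chosen for each state. As there are
finitely many traces, every set `X` of states is defined by a formula `charForm e χ X`, so `X` can
be declared effective for `G` at `s` when `[G]` of that formula lies in the theory of `s`. E1–E5
then mirror the coalition axioms, and E6 holds by finiteness. States are `R G`-related when they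
agree on all listed `D_H χ` with `H ⊆ G`; this is visibly an equivalence, antitone in `G`. The S5
axioms give the witnesses for failing `D_G` (`exists_of_dist_notMem`), and induction on formulas
gives the truth lemma `sat_filtration_iff`. -/

/-- A consistent set of formulas that contains all theorems and is closed under modus ponens. -/
structure IsTheory (T : Set (Form N Θ)) : Prop where
  thm : ∀ {φ}, CLD φ → φ ∈ T
  mp : ∀ {φ ψ}, imp φ ψ ∈ T → φ ∈ T → ψ ∈ T
  cons : ∀ φ, φ ∈ T → neg φ ∉ T

/-- A theory that decides every formula. -/
structure IsMaxTheory (T : Set (Form N Θ)) : Prop extends IsTheory T where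
  total : ∀ φ, φ ∈ T ∨ neg φ ∈ T

theorem propEval_imp (v : Form N Θ → Prop) (φ ψ : Form N Θ) :
    propEval v (imp φ ψ) ↔ (propEval v φ → propEval v ψ) := by
  simp only [imp, propEval]; tauto

/-- Every theory extends to a maximal one. -/
theorem IsTheory.exists_isMaxTheory {T : Set (Form N Θ)} (hT : IsTheory T) :
    ∃ U, T ⊆ U ∧ IsMaxTheory U := by
  obtain ⟨U, hTU, hU⟩ := zorn_subset_nonempty {U : Set (Form N Θ) | IsTheory U} (by
    intro c hc hchain hne
    refine ⟨⋃₀ c, ⟨?_, ?_, ?_⟩, fun s hs => Set.subset_sUnion_of_mem hs⟩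
    · intro φ hφ
      obtain ⟨U, hU⟩ := hne
      exact ⟨U, hU, (hc hU).thm hφ⟩
    · rintro φ ψ ⟨U, hU, h₁⟩ ⟨W, hW, h₂⟩
      rcases hchain.total hU hW with h | h
      · exact ⟨W, hW, (hc hW).mp (h h₁) h₂⟩
      · exact ⟨U, hU, (hc hU).mp h₁ (h h₂)⟩
    · rintro φ ⟨U, hU, h₁⟩ ⟨W, hW, h₂⟩
      rcases hchain.total hU hW with h | h
      · exact (hc hW).cons φ (h h₁) h₂
      · exact (hc hU).cons φ h₁ (h h₂)) T hT
  have hth : IsTheory U := hU.prop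
  refine ⟨U, hTU, hth, fun φ => ?_⟩
  by_contra! hφ
  -- Adjoining `φ` keeps `U` consistent: otherwise `¬φ` would already be in `U`.
  have hW : IsTheory {ψ | imp φ ψ ∈ U} := by
    refine ⟨fun {ψ} h => ?_, fun {ψ χ} h₁ h₂ => ?_, fun ψ h₁ h₂ => hφ.2 ?_⟩
    · exact hth.mp (hth.thm (CLD.prop fun v => by simp only [propEval_imp]; tauto)) (hth.thm h)
    · exact hth.mp (hth.mp (hth.thm (CLD.prop fun v => by simp only [propEval_imp]; tauto)) h₁) h₂
    · exact hth.mp (hth.mp (hth.thm (CLD.prop fun v => by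
        simp only [propEval_imp, propEval]; tauto)) h₁) h₂
  have hsub : U ⊆ {ψ | imp φ ψ ∈ U} := fun ψ h =>
    hth.mp (hth.thm (CLD.prop fun v => by simp only [propEval_imp]; tauto)) h
  have hmem : imp φ φ ∈ U := hth.thm (CLD.prop fun v => by simp only [propEval_imp]; tauto)
  exact hφ.1 (hU.le_of_ge hW hsub hmem)

/-- The theory of the consequences of a consistent formula. -/
theorem Consistent.isTheory {φ : Form N Θ} (hφ : Consistent φ) :
    IsTheory {ψ | CLD (imp φ ψ)} where
  thm h := CLD.MP h (CLD.prop fun v => by simp only [propEval_imp]; tauto)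
  mp h₁ h₂ := CLD.MP h₂ (CLD.MP h₁ (CLD.prop fun v => by simp only [propEval_imp]; tauto))
  cons ψ h₁ h₂ := hφ (CLD.MP h₂ (CLD.MP h₁ (CLD.prop fun v => by
    simp only [propEval_imp, propEval]; tauto)))

theorem Consistent.exists_isMaxTheory {φ : Form N Θ} (hφ : Consistent φ) :
    ∃ U, IsMaxTheory U ∧ φ ∈ U := by
  obtain ⟨U, hU, hmax⟩ := hφ.isTheory.exists_isMaxTheory
  exact ⟨U, hmax, hU (CLD.prop fun v => by simp only [propEval_imp]; tauto)⟩

/-- Formulas in the same maximal theories are thus provably equivalent, which is what the rule for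
`[H]` needs. -/
theorem CLD.of_forall_isMaxTheory {φ : Form N Θ} (h : ∀ U, IsMaxTheory U → φ ∈ U) : CLD φ := by
  by_contra hφ
  have hc : Consistent (neg φ) := fun h' =>
    hφ (CLD.MP h' (CLD.prop fun v => by simp only [propEval_imp, propEval]; tauto))
  obtain ⟨U, hU, hmem⟩ := hc.exists_isMaxTheory
  exact hU.cons φ (h U hU) hmem

namespace IsMaxTheory

variable {T : Set (Form N Θ)}

theorem neg_mem (hT : IsMaxTheory T) {φ : Form N Θ} : neg φ ∈ T ↔ φ ∉ T :=
  ⟨fun h h' => hT.cons φ h' h, fun h => (hT.total φ).resolve_left h⟩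

theorem and_mem (hT : IsMaxTheory T) {φ ψ : Form N Θ} : and φ ψ ∈ T ↔ φ ∈ T ∧ ψ ∈ T := by
  refine ⟨fun h => ⟨?_, ?_⟩, fun h => ?_⟩
  · exact hT.mp (hT.thm (CLD.prop fun v => by simp only [propEval_imp, propEval]; tauto)) h
  · exact hT.mp (hT.thm (CLD.prop fun v => by simp only [propEval_imp, propEval]; tauto)) h
  · exact hT.mp (hT.mp (hT.thm (CLD.prop fun v => by
      simp only [propEval_imp, propEval]; tauto)) h.1) h.2

theorem imp_mem (hT : IsMaxTheory T) {φ ψ : Form N Θ} : imp φ ψ ∈ T ↔ (φ ∈ T → ψ ∈ T) := by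
  simp only [imp, hT.neg_mem, hT.and_mem]; tauto

theorem iff_mem (hT : IsMaxTheory T) {φ ψ : Form N Θ} : iff φ ψ ∈ T ↔ (φ ∈ T ↔ ψ ∈ T) := by
  simp only [Form.iff, hT.and_mem, hT.imp_mem]; tauto

theorem bot_mem (hT : IsMaxTheory T) {χ : Form N Θ} : bot χ ∈ T ↔ False := by
  simp only [bot, hT.and_mem, hT.neg_mem]; tauto

theorem top_mem (hT : IsMaxTheory T) {χ : Form N Θ} : top χ ∈ T ↔ True := by
  simp only [top, hT.bot_mem, hT.neg_mem]; tauto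

theorem coal_congr (hT : IsMaxTheory T) (G : Set N) {φ ψ : Form N Θ}
    (h : ∀ U, IsMaxTheory U → (φ ∈ U ↔ ψ ∈ U)) : coal G φ ∈ T ↔ coal G ψ ∈ T :=
  hT.iff_mem.1 (hT.thm (CLD.RG G (CLD.of_forall_isMaxTheory fun U hU => hU.iff_mem.2 (h U hU))))

theorem coal_mono (hT : IsMaxTheory T) (G : Set N) {φ ψ : Form N Θ}
    (h : ∀ U, IsMaxTheory U → φ ∈ U → ψ ∈ U) (hφ : coal G φ ∈ T) : coal G ψ ∈ T := by
  refine hT.mp (hT.thm (CLD.G4 G φ ψ)) ((hT.coal_congr G fun U hU => ?_).1 hφ)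
  rw [hU.and_mem]
  exact ⟨fun h' => ⟨h', h U hU h'⟩, And.left⟩

theorem dist_mono (hT : IsMaxTheory T) {G H : NECoalition N} (h : G.1 ⊆ H.1) {φ : Form N Θ}
    (hφ : dist G φ ∈ T) : dist H φ ∈ T :=
  hT.mp (hT.thm (CLD.D2 G H h φ)) hφ

/-- Necessitation is a rule only for `K_i`; pick `i ∈ G` and pass through `D_i`. -/
theorem dist_of_cld (hT : IsMaxTheory T) (G : NECoalition N) {φ : Form N Θ} (hφ : CLD φ) :
    dist G φ ∈ T := by
  obtain ⟨i, hi⟩ := G.2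
  refine hT.dist_mono (G := NECoalition.single i) (Set.singleton_subset_iff.2 hi) ?_
  exact (hT.iff_mem.1 (hT.thm (CLD.D1 i φ))).1 (hT.thm (CLD.RN i hφ))

theorem dist_mp (hT : IsMaxTheory T) {G : NECoalition N} {φ ψ : Form N Θ}
    (h : dist G (imp φ ψ) ∈ T) (hφ : dist G φ ∈ T) : dist G ψ ∈ T :=
  hT.mp (hT.mp (hT.thm (CLD.DK G φ ψ)) h) hφ

/-- If `D_G ψ` fails at `T`, then `¬ψ` holds at a maximal theory which agrees with `T` on all the
formulas `D_H χ` with `H ⊆ G`. -/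
theorem exists_of_dist_notMem (hT : IsMaxTheory T) {G : NECoalition N} {ψ : Form N Θ}
    (h : dist G ψ ∉ T) :
    ∃ U, IsMaxTheory U ∧ ψ ∉ U ∧
      ∀ H : NECoalition N, H.1 ⊆ G.1 → ∀ χ, (dist H χ ∈ T ↔ dist H χ ∈ U) := by
  -- The consequences of `¬ψ` under `D_G`; a contradiction among them would yield `D_G ψ ∈ T`.
  have hth : IsTheory {χ | dist G (imp (neg ψ) χ) ∈ T} := by
    refine ⟨fun hχ => hT.dist_of_cld G ?_, fun h₁ h₂ => hT.dist_mp (hT.dist_mp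
      (hT.dist_of_cld G ?_) h₁) h₂, fun χ h₁ h₂ => h (hT.dist_mp (hT.dist_mp
      (hT.dist_of_cld G ?_) h₁) h₂)⟩
    · exact CLD.MP hχ (CLD.prop fun v => by simp only [propEval_imp]; tauto)
    · exact CLD.prop fun v => by simp only [propEval_imp]; tauto
    · exact CLD.prop fun v => by simp only [propEval_imp, propEval]; tauto
  obtain ⟨U, hsub, hU⟩ := hth.exists_isMaxTheory
  have key : ∀ χ, dist G χ ∈ T → χ ∈ U := fun χ hχ => hsub (hT.dist_mp (hT.dist_of_cld G
    (CLD.prop fun v => by simp only [propEval_imp]; tauto)) hχ)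
  refine ⟨U, hU, ?_, fun H hH χ => ⟨fun hχ => ?_, fun hχ => ?_⟩⟩
  · refine hU.neg_mem.1 (hsub (hT.dist_of_cld G ?_))
    exact CLD.prop fun v => by simp only [propEval_imp]; tauto
  -- Axiom 4 transfers `D_H χ` to `U`, and axiom 5 transfers its negation.
  · exact key _ (hT.dist_mono hH (hT.mp (hT.thm (CLD.D4 H χ)) hχ))
  · by_contra hn
    refine hU.cons _ hχ (key _ (hT.dist_mono hH ?_))
    exact hT.mp (hT.thm (CLD.D5 H χ)) (hT.neg_mem.2 hn)

end IsMaxTheory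

/-- The subformulas of a formula, together with `D_i φ` for each subformula `K_i φ`. -/
def Form.closure : Form N Θ → Set (Form N Θ)
  | atom p => {atom p}
  | neg φ => insert (neg φ) φ.closure
  | and φ ψ => insert (and φ ψ) (φ.closure ∪ ψ.closure)
  | coal G φ => insert (coal G φ) φ.closure
  | know i φ => insert (know i φ) (insert (dist (NECoalition.single i) φ) φ.closure)
  | dist G φ => insert (dist G φ) φ.closure

theorem Form.finite_closure (φ : Form N Θ) : φ.closure.Finite := by
  induction φ with
  | atom p => exact Set.finite_singleton _
  | neg φ ih => exact ih.insert _
  | and φ ψ ih₁ ih₂ => exact (ih₁.union ih₂).insert _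
  | coal G φ ih => exact ih.insert _
  | know i φ ih => exact (ih.insert _).insert _
  | dist G φ ih => exact ih.insert _

theorem Form.self_mem_closure (φ : Form N Θ) : φ ∈ φ.closure := by
  cases φ <;> simp [Form.closure]

/-! ### Filtration through a finite list of formulas -/

section Filtration

variable {n : ℕ} (e : Fin n → Form N Θ)

/-- The indices of the formulas from the list `e` that belong to `T`. -/
def trace (T : Set (Form N Θ)) : Set (Fin n) := {k | e k ∈ T}

/-- The traces of maximal theories on the list `e`. -/
abbrev FState : Type := {x : Set (Fin n) // ∃ T, IsMaxTheory T ∧ trace e T = x}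

variable {e}

/-- The state given by a maximal theory. -/
def IsMaxTheory.state {T : Set (Form N Θ)} (hT : IsMaxTheory T) : FState e :=
  ⟨trace e T, T, hT, rfl⟩

/-- A maximal theory with the given trace. -/
noncomputable def FState.theory (s : FState e) : Set (Form N Θ) := s.2.choose

theorem FState.isMaxTheory (s : FState e) : IsMaxTheory s.theory := s.2.choose_spec.1

theorem FState.trace_theory (s : FState e) : trace e s.theory = s.1 := s.2.choose_spec.2

/-- The chosen theory may differ from `T`, but not on listed formulas. -/
theorem IsMaxTheory.mem_theory_state {T : Set (Form N Θ)} (hT : IsMaxTheory T) {φ : Form N Θ}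
    (hφ : φ ∈ Set.range e) : φ ∈ (hT.state : FState e).theory ↔ φ ∈ T := by
  obtain ⟨k, rfl⟩ := hφ
  exact Set.ext_iff.1 (hT.state : FState e).trace_theory k

variable (e)

/-- Take the conjunction of the listed formulas or their negations, as `a` prescribes. -/
theorem exists_form_trace_eq (χ : Form N Θ) (a : Set (Fin n)) :
    ∃ f : Form N Θ, ∀ T, IsMaxTheory T → (f ∈ T ↔ trace e T = a) := by
  suffices h : ∀ s : Finset (Fin n), ∃ f : Form N Θ, ∀ T, IsMaxTheory T →
      (f ∈ T ↔ ∀ k ∈ s, (e k ∈ T ↔ k ∈ a)) by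
    obtain ⟨f, hf⟩ := h Finset.univ
    exact ⟨f, fun T hT => (hf T hT).trans (by simp [trace, Set.ext_iff])⟩
  intro s
  induction s using Finset.induction_on with
  | empty => exact ⟨top χ, fun T hT => by simp [hT.top_mem]⟩
  | insert k s _ ih =>
    obtain ⟨f, hf⟩ := ih
    by_cases hk : k ∈ a
    · exact ⟨and (e k) f, fun T hT => by simp [hT.and_mem, hf T hT, hk]⟩
    · exact ⟨and (neg (e k)) f, fun T hT => by simp [hT.and_mem, hT.neg_mem, hf T hT, hk]⟩

theorem exists_form_trace_mem (χ : Form N Θ) (X : Set (Set (Fin n))) :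
    ∃ f : Form N Θ, ∀ T, IsMaxTheory T → (f ∈ T ↔ trace e T ∈ X) := by
  induction X, X.toFinite using Set.Finite.induction_on with
  | empty => exact ⟨bot χ, fun T hT => by simp [hT.bot_mem]⟩
  | @insert a X _ _ ih =>
    obtain ⟨f, hf⟩ := ih
    obtain ⟨g, hg⟩ := exists_form_trace_eq e χ a
    refine ⟨imp (neg g) f, fun T hT => ?_⟩
    rw [hT.imp_mem, hT.neg_mem, hg T hT, hf T hT, Set.mem_insert_iff]
    tauto

theorem exists_charForm (χ : Form N Θ) (X : Set (FState e)) :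
    ∃ f : Form N Θ, ∀ T, ∀ hT : IsMaxTheory T, f ∈ T ↔ hT.state ∈ X := by
  obtain ⟨f, hf⟩ := exists_form_trace_mem e χ (Subtype.val '' X)
  refine ⟨f, fun T hT => (hf T hT).trans ⟨?_, fun h => ⟨_, h, rfl⟩⟩⟩
  rintro ⟨s, hs, hst⟩
  rwa [show hT.state = s from Subtype.ext hst.symm]

/-- A formula which characterizes a set of states. -/
noncomputable def charForm (χ : Form N Θ) (X : Set (FState e)) : Form N Θ :=
  (exists_charForm e χ X).choose

variable {e}

theorem IsMaxTheory.charForm_mem {T : Set (Form N Θ)} (hT : IsMaxTheory T) (χ : Form N Θ)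
    (X : Set (FState e)) : charForm e χ X ∈ T ↔ hT.state ∈ X :=
  (exists_charForm e χ X).choose_spec T hT

variable (e)

/-- Set operations on `X` match connectives on `charForm e χ X` up to provable equivalence. -/
theorem trulyPlayable_charForm (χ : Form N Θ) (s : FState e) :
    TrulyPlayable fun G : Set N => {X : Set (FState e) | coal G (charForm e χ X) ∈ s.theory} := by
  have hs := s.isMaxTheory
  have h2 : ∀ G : Set N, coal G (charForm e χ Set.univ) ∈ s.theory := fun G =>
    (hs.coal_congr G fun U hU => by simp [hU.charForm_mem, hU.top_mem]).1 (hs.thm (CLD.G2 G χ))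
  refine ⟨fun G h => ?_, h2, fun X h => ?_, fun G X Y hXY h => ?_,
    fun G₁ G₂ X Y hG hX hY => ?_, ?_⟩
  · refine hs.cons _ ?_ (hs.thm (CLD.G1 G χ))
    exact (hs.coal_congr G fun U hU => by simp [hU.charForm_mem, hU.bot_mem]).1 h
  · refine hs.mp (hs.thm (CLD.G3 _)) (hs.neg_mem.2 fun h' => h ?_)
    exact (hs.coal_congr ∅ fun U hU => by simp [hU.charForm_mem, hU.neg_mem]).1 h'
  · refine hs.coal_mono G (fun U hU => ?_) h
    rw [hU.charForm_mem, hU.charForm_mem]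
    exact fun h => hXY h
  · have h := hs.mp (hs.thm (CLD.G5 G₁ G₂ hG _ _)) (hs.and_mem.2 ⟨hX, hY⟩)
    exact (hs.coal_congr _ fun U hU => by simp [hU.charForm_mem, hU.and_mem]).1 h
  -- E6: strict inclusion is well-founded on subsets of a finite set.
  · obtain ⟨X, hX, hmin⟩ := (wellFounded_lt (α := Set (FState e))).has_min
      {X | coal ∅ (charForm e χ X) ∈ s.theory} ⟨_, h2 ∅⟩
    exact ⟨X, hX, fun ⟨Y, hY, hlt⟩ => hmin Y hY hlt⟩

/-- Two states agree on the listed formulas `D_H χ` with `H ⊆ G`. -/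
def distRel (G : NECoalition N) (s t : FState e) : Prop :=
  ∀ H : NECoalition N, H.1 ⊆ G.1 → ∀ χ, dist H χ ∈ Set.range e →
    (dist H χ ∈ s.theory ↔ dist H χ ∈ t.theory)

theorem distRel_equivalence (G : NECoalition N) : Equivalence (distRel e G) where
  refl _ _ _ _ _ := Iff.rfl
  symm h H hH χ hχ := (h H hH χ hχ).symm
  trans h h' H hH χ hχ := (h H hH χ hχ).trans (h' H hH χ hχ)

/-- The filtration of the canonical pseudomodel through the list `e`; the formula `χ` only serves
to build `⊤` and `⊥`. -/
noncomputable def filtration (χ : Form N Θ) (s₀ : FState e) : Pseudomodel N Θ (FState e) where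
  nonempty := ⟨s₀⟩
  E s G := {X | coal G (charForm e χ X) ∈ s.theory}
  trulyPlayable := trulyPlayable_charForm e χ
  sim i := distRel e (NECoalition.single i)
  sim_equiv _ := distRel_equivalence e _
  V s := {p | atom p ∈ s.theory}
  R := distRel e
  R_equiv := distRel_equivalence e
  R_single _ := rfl
  R_anti _ _ hGH _ _ h H hH := h H (hH.trans hGH)

variable {e}

theorem dist_mem_theory_iff {G : NECoalition N} {ψ : Form N Θ} (hD : dist G ψ ∈ Set.range e)
    (hψ : ψ ∈ Set.range e) (s : FState e) :
    dist G ψ ∈ s.theory ↔ ∀ t, distRel e G s t → ψ ∈ t.theory := by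
  refine ⟨fun h t hst => ?_, fun h => ?_⟩
  · exact t.isMaxTheory.mp (t.isMaxTheory.thm (CLD.DT G ψ)) ((hst G subset_rfl ψ hD).1 h)
  · by_contra hn
    obtain ⟨U, hU, hψU, hHU⟩ := s.isMaxTheory.exists_of_dist_notMem hn
    refine hψU ((hU.mem_theory_state hψ).1 (h hU.state fun H hH χ hχ => ?_))
    rw [hU.mem_theory_state hχ]
    exact hHU H hH χ

theorem sat_filtration_iff (χ : Form N Θ) (s₀ : FState e) (ψ : Form N Θ)
    (hψ : ψ.closure ⊆ Set.range e) (s : FState e) :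
    (filtration e χ s₀).Sat s ψ ↔ ψ ∈ s.theory := by
  induction ψ generalizing s with
  | atom p => rfl
  | neg ψ ih =>
    rw [s.isMaxTheory.neg_mem, ← ih ((Set.subset_insert _ _).trans hψ) s]
    rfl
  | and ψ₁ ψ₂ ih₁ ih₂ =>
    have h := (Set.subset_insert _ _).trans hψ
    rw [s.isMaxTheory.and_mem, ← ih₁ (Set.subset_union_left.trans h) s,
      ← ih₂ (Set.subset_union_right.trans h) s]
    rfl
  | coal G ψ ih =>
    have h : ψ.closure ⊆ Set.range e := (Set.subset_insert _ _).trans hψ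
    -- By induction, the formula characterizing the truth set of `ψ` is provably equivalent to `ψ`.
    refine s.isMaxTheory.coal_congr G fun U hU => ?_
    rw [hU.charForm_mem, Set.mem_ofPred_eq, ih h, hU.mem_theory_state (h ψ.self_mem_closure)]
  | know i ψ ih =>
    have h' := (Set.subset_insert _ _).trans hψ
    have h : ψ.closure ⊆ Set.range e := (Set.subset_insert _ _).trans h'
    -- Reduce `K_i` to `D_i`; for this the closure contains `D_i ψ`.
    rw [s.isMaxTheory.iff_mem.1 (s.isMaxTheory.thm (CLD.D1 i ψ)),
      dist_mem_theory_iff (h' (Set.mem_insert _ _)) (h ψ.self_mem_closure)]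
    exact forall_congr' fun t => imp_congr_right fun _ => ih h t
  | dist G ψ ih =>
    have h : ψ.closure ⊆ Set.range e := (Set.subset_insert _ _).trans hψ
    rw [dist_mem_theory_iff (hψ (Set.mem_insert _ _)) (h ψ.self_mem_closure)]
    exact forall_congr' fun t => imp_congr_right fun _ => ih h t

end Filtration

end CoalitionLogic

open CoalitionLogic in
theorem mainTheorem6 {N : Type*} [Finite N] {Θ : Type*} (φ : CoalitionLogic.Form N Θ)
    (hφ : CoalitionLogic.Consistent φ) :
    ∃ (S : Type) (_ : Finite S) (M : CoalitionLogic.Pseudomodel N Θ S) (s : S), M.Sat s φ := by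
  obtain ⟨n, e, he⟩ := φ.finite_closure.fin_embedding
  obtain ⟨U, hU, hmem⟩ := hφ.exists_isMaxTheory
  let s₀ : FState e := hU.state
  refine ⟨FState e, inferInstance, filtration e φ s₀, s₀, ?_⟩
  rw [sat_filtration_iff φ s₀ φ he.ge s₀]
  exact (hU.mem_theory_state (he.ge φ.self_mem_closure)).2 hmem
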